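/- Let $n\ge 1$, $1\le j\le n$, let $\Omega\subset\mathbb R^n$ be a bounded open set, let $\rho>0$ and let $\varphi\in C_0^\infty(B(0,\rho))$. For $f\in L^2(\mathbb R^n)$ vanishing outside $\Omega$ and $0<\varepsilon<1$ put $$T_\varepsilon f(x)=\int_\varepsilon^1\int_{\mathbb R^n}\frac{\partial}{\partial x_j}\left[\varphi\left(y+\frac{x-y}{t}\right)\right]f(y)\,dy\,\frac{dt}{t^n},\qquad x\in\mathbb R^n .$$ These integrals converge absolutely, each $T_\varepsilon f$ defines a tempered distribution, and the limit $Tf=\lim_{\varepsilon\to0^+}T_\varepsilon f$ exists in the space $\mathcal S'(\mathbb R^n)$ of tempered distributions. Moreover $Tf$ is a function in $L^2(\mathbb R^n)$, and $$\|Tf\|_{L^2(\Omega)}\le\left(2^{\frac{n-1}{2}}\rho^{-1}\|\varphi\|_{L^1(\mathbb R^n)}+2^{\frac{n-1}{2}}\rho\left\|\frac{\partial^2\varphi}{\partial x_j^2}\right\|_{L^1(\mathbb R^n)}+2^n|\Omega|\left\|\frac{\partial\varphi}{\partial x_j}\right\|_{L^\infty(\mathbb R^n)}\right)\|f\|_{L^2(\Omega)}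 .$$ -/

import Mathlib

open MeasureTheory Filter Topology Set
open scoped ENNReal ContDiff SchwartzMap

noncomputable section

/-- The partial derivative `∂φ/∂x_j` of a function on `ℝⁿ`. -/
def partialDeriv {n : ℕ} (j : Fin n) (φ : EuclideanSpace ℝ (Fin n) → ℂ)
    (x : EuclideanSpace ℝ (Fin n)) : ℂ :=
  lineDeriv ℝ φ x (EuclideanSpace.single j 1)

/-- The integrand `∂/∂x_j [φ (y + (x - y) / t)] f(y) t⁻ⁿ`, the derivative being taken with respect
to `x`, with `y` and `t` fixed. -/
def singularIntegrand {n : ℕ} (φ : EuclideanSpace ℝ (Fin n) → ℂ) (j : Fin n)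
    (f : EuclideanSpace ℝ (Fin n) → ℂ) (x : EuclideanSpace ℝ (Fin n)) (t : ℝ)
    (y : EuclideanSpace ℝ (Fin n)) : ℂ :=
  partialDeriv j (fun z => φ (y + t⁻¹ • (z - y))) x * f y * ((t ^ n)⁻¹ : ℝ)

/-- The truncated operator
`T_ε f (x) = ∫_ε^1 ∫ ∂/∂x_j [φ (y + (x - y) / t)] f(y) dy dt / tⁿ`. -/
def truncatedOp {n : ℕ} (φ : EuclideanSpace ℝ (Fin n) → ℂ) (j : Fin n) (ε : ℝ)
    (f : EuclideanSpace ℝ (Fin n) → ℂ) (x : EuclideanSpace ℝ (Fin n)) : ℂ :=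
  ∫ t in ε..1, ∫ y, singularIntegrand φ j f x t y

/-- The double integral defining `T_ε f (x)` converges absolutely for every `x` and every
`0 < ε < 1`. -/
def TruncatedOpConverges {n : ℕ} (φ : EuclideanSpace ℝ (Fin n) → ℂ) (j : Fin n)
    (f : EuclideanSpace ℝ (Fin n) → ℂ) : Prop :=
  ∀ ε ∈ Ioo (0 : ℝ) 1, ∀ x : EuclideanSpace ℝ (Fin n),
    Integrable (fun p : ℝ × EuclideanSpace ℝ (Fin n) => singularIntegrand φ j f x p.1 p.2)
      ((volume.restrict (Ioc ε 1)).prod volume)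

/-- The tempered distribution `U` is (given by integration against) the function `u`. -/
def IsGivenBy {n : ℕ} (U : 𝓢'(EuclideanSpace ℝ (Fin n), ℂ))
    (u : EuclideanSpace ℝ (Fin n) → ℂ) : Prop :=
  ∀ g : 𝓢(EuclideanSpace ℝ (Fin n), ℂ),
    Integrable (fun x => g x * u x) ∧ U g = ∫ x, g x * u x

/-- `U = T f`, where `T f = lim_{ε → 0⁺} T_ε f` in the space of tempered distributions: the
functions `T_ε f` are well defined by absolutely convergent integrals, they are tempered
distributions, and as such they converge to `U`. -/
def IsSingularIntegralOf {n : ℕ} (φ : EuclideanSpace ℝ (Fin n) → ℂ) (j : Fin n)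
    (f : EuclideanSpace ℝ (Fin n) → ℂ) (U : 𝓢'(EuclideanSpace ℝ (Fin n), ℂ)) : Prop :=
  TruncatedOpConverges φ j f ∧
    ∃ S : ℝ → 𝓢'(EuclideanSpace ℝ (Fin n), ℂ),
      (∀ ε ∈ Ioo (0 : ℝ) 1, IsGivenBy (S ε) (truncatedOp φ j ε f)) ∧
        Tendsto S (𝓝[>] 0) (𝓝 U)

end

open scoped FourierTransform LineDeriv

section

variable {n : ℕ}

/-! The `t`-integral is cut at `t = 1/2`. On `1/2 < t ≤ 1` the kernel is bounded, which gives a sup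
bound by `‖f‖₁`; passing between `L¹`, `L²` and `L^∞` over `Ω` costs `|Ω|` and produces the last
term of the estimate.

On `0 < t ≤ 1/2` the Fourier transform is used. With `m` the transform of `∂φ/∂x_j` and `F` that of
`f`, the transform of this piece is `∫ t⁻¹ m(tξ) F((1-t)ξ) dt` (`fourier_shellOp`). Differentiating
once and twice gives `|m(η)| ≤ 2π|η_j| ‖φ‖₁` and `2π|η_j| |m(η)| ≤ ‖∂_j²φ‖₁`, so `t⁻¹|m(tξ)|` is
bounded near `t = 0` and decays like `t⁻²`. Its `t`-integral is therefore at most `C = ρ⁻¹‖φ‖₁ +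
ρ‖∂_j²φ‖₁`, uniformly in `ξ` off the null set `ξ_j = 0`.

A Schur test with this weight (`lintegral_sq_lintegral_le`) bounds the operator in `L²`: one
marginal is at most `C`, the other, after `η = (1-t)ξ`, at most `2^(n-1) C`. Plancherel then gives
the factor `2^((n-1)/2) C`. The estimate holds with absolute values inside the `t`-integral, so the
same majorant dominates every truncation and yields convergence against Schwartz functions. -/

/-! ### The scalar integral behind the constant. -/

theorem lintegral_Ioc_inv_sq_le {b r τ : ℝ} (hb : 0 ≤ b) (hr : 0 < r) (hτ : 0 < τ) (hτ1 : τ ≤ 1) :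
    ∫⁻ t in Ioc τ 1, ENNReal.ofReal (b / (t ^ 2 * r)) ≤ ENNReal.ofReal (b / r * (τ⁻¹ - 1)) := by
  have hd : ∀ t ∈ uIcc τ 1, HasDerivAt (fun t : ℝ => -(b / r * t⁻¹)) (b / (t ^ 2 * r)) t := by
    intro t ht
    rw [uIcc_of_le hτ1] at ht
    have ht0 : t ≠ 0 := (hτ.trans_le ht.1).ne'
    have := ((hasDerivAt_inv ht0).const_mul (b / r)).neg
    refine this.congr_deriv ?_
    field_simp
  have hc : ContinuousOn (fun t : ℝ => b / (t ^ 2 * r)) (uIcc τ 1) := by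
    intro t ht
    rw [uIcc_of_le hτ1] at ht
    have ht0 : t ≠ 0 := (hτ.trans_le ht.1).ne'
    refine ContinuousAt.continuousWithinAt ?_
    exact ContinuousAt.div (by fun_prop) (by fun_prop) (by positivity)
  have hi := hc.intervalIntegrable (μ := volume)
  have hI := intervalIntegral.integral_eq_sub_of_hasDerivAt hd hi
  rw [intervalIntegral.integral_of_le hτ1] at hI
  rw [intervalIntegrable_iff_integrableOn_Ioc_of_le hτ1] at hi
  rw [← ofReal_integral_eq_lintegral_ofReal hi
    (Eventually.of_forall fun t => by positivity), hI]
  apply le_of_eq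
  congr 1
  ring

theorem lintegral_Ioc_one_sub_inv_sq_le {a r τ : ℝ} (ha : 0 ≤ a) (hr : 0 < r) (hτ : 0 < τ)
    (hτ1 : τ < 1) :
    ∫⁻ t in Ioc 0 τ, ENNReal.ofReal (r * a / (1 - t) ^ 2) ≤
      ENNReal.ofReal (r * a * ((1 - τ)⁻¹ - 1)) := by
  have hpos : ∀ t ∈ uIcc 0 τ, 0 < 1 - t := by
    intro t ht
    rw [uIcc_of_le hτ.le] at ht
    linarith [ht.2]
  have hd : ∀ t ∈ uIcc 0 τ,
      HasDerivAt (fun t : ℝ => r * a * (1 - t)⁻¹) (r * a / (1 - t) ^ 2) t := by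
    intro t ht
    have h0 := (hpos t ht).ne'
    have := (((hasDerivAt_id t).const_sub 1).inv h0).const_mul (r * a)
    refine this.congr_deriv ?_
    simp only [id, neg_neg]
    ring
  have hc : ContinuousOn (fun t : ℝ => r * a / (1 - t) ^ 2) (uIcc 0 τ) := by
    intro t ht
    have h0 := hpos t ht
    refine ContinuousAt.continuousWithinAt ?_
    exact ContinuousAt.div (by fun_prop) (by fun_prop) (by positivity)
  have hi := hc.intervalIntegrable (μ := volume)
  have hI := intervalIntegral.integral_eq_sub_of_hasDerivAt hd hi
  rw [intervalIntegral.integral_of_le hτ.le] at hI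
  rw [intervalIntegrable_iff_integrableOn_Ioc_of_le hτ.le] at hi
  rw [← ofReal_integral_eq_lintegral_ofReal hi
    (Eventually.of_forall fun t => by positivity), hI]
  apply le_of_eq
  congr 1
  simp
  ring

/-- In the variable `s = t / (1 - t)` the integrand becomes `min (r a) (b / (r s²)) ds` on the
half-line. Using the first bound for `s ≤ 1 / (ρ r)` and the second beyond gives exactly `ρ⁻¹ a` and
`ρ b`. -/
theorem lintegral_Ioc_min_le {a b r ρ : ℝ} (ha : 0 ≤ a) (hb : 0 ≤ b) (hr : 0 < r) (hρ : 0 < ρ) :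
    ∫⁻ t in Ioc 0 1, ENNReal.ofReal (min (r * a / (1 - t) ^ 2) (b / (t ^ 2 * r))) ≤
      ENNReal.ofReal (ρ⁻¹ * a + ρ * b) := by
  -- This is the value of `t` at which `t / (1 - t) = 1 / (ρ r)`.
  set τ := (1 + ρ * r)⁻¹ with hτ
  have hρr : 0 < ρ * r := by positivity
  have hτ0 : 0 < τ := by positivity
  have hτ1 : τ < 1 := inv_lt_one_of_one_lt₀ (by linarith)
  rw [← Ioc_union_Ioc_eq_Ioc hτ0.le hτ1.le, ENNReal.ofReal_add (by positivity) (by positivity)]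
  refine (lintegral_union_le _ _ _).trans (add_le_add ?_ ?_)
  · refine (lintegral_mono fun t => ENNReal.ofReal_le_ofReal (min_le_left _ _)).trans
      ((lintegral_Ioc_one_sub_inv_sq_le ha hr hτ0 hτ1).trans (le_of_eq ?_))
    congr 1
    have h : 1 - τ = ρ * r * τ := by rw [hτ]; field_simp; ring
    rw [h, hτ]
    field_simp
    ring
  · refine (lintegral_mono fun t => ENNReal.ofReal_le_ofReal (min_le_right _ _)).trans
      ((lintegral_Ioc_inv_sq_le hb hr hτ0 hτ1.le).trans (le_of_eq ?_))
    congr 1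
    rw [hτ, inv_inv]
    field_simp
    ring


/-! ### Fourier transform: derivatives, duality and Plancherel. -/

theorem partialDeriv_eq_lineDerivOp (j : Fin n) {φ : EuclideanSpace ℝ (Fin n) → ℂ}
    (Φ : 𝓢(EuclideanSpace ℝ (Fin n), ℂ)) (h : ∀ x, Φ x = φ x) :
    partialDeriv j φ = (∂_{EuclideanSpace.single j (1 : ℝ)} Φ : 𝓢(EuclideanSpace ℝ (Fin n), ℂ)) := by
  have : φ = Φ := (funext h).symm
  subst this
  ext x
  rw [partialDeriv, SchwartzMap.lineDerivOp_apply]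

theorem norm_fourier_partialDeriv (j : Fin n) (Φ : 𝓢(EuclideanSpace ℝ (Fin n), ℂ))
    (ξ : EuclideanSpace ℝ (Fin n)) :
    ‖𝓕 (partialDeriv j Φ) ξ‖ = 2 * Real.pi * |ξ j| * ‖𝓕 (Φ : EuclideanSpace ℝ (Fin n) → ℂ) ξ‖ := by
  rw [partialDeriv_eq_lineDerivOp j Φ fun _ => rfl, ← SchwartzMap.fourier_coe,
    SchwartzMap.fourier_lineDerivOp_eq, ← SchwartzMap.fourier_coe]
  have : (fun x : EuclideanSpace ℝ (Fin n) =>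
      inner ℝ x (EuclideanSpace.single j (1 : ℝ))).HasTemperateGrowth := by fun_prop
  rw [smul_apply, SchwartzMap.smulLeftCLM_apply_apply this]
  simp [EuclideanSpace.inner_single_right, abs_of_pos Real.pi_pos]
  ring

theorem norm_fourier_le_lpNorm_one (Φ : 𝓢(EuclideanSpace ℝ (Fin n), ℂ))
    (ξ : EuclideanSpace ℝ (Fin n)) :
    ‖𝓕 (Φ : EuclideanSpace ℝ (Fin n) → ℂ) ξ‖ ≤ lpNorm Φ 1 volume := by
  rw [lpNorm_one_eq_integral_norm Φ.continuous.aestronglyMeasurable]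
  exact VectorFourier.norm_fourierIntegral_le_integral_norm _ _ _ _ _

theorem integral_fourier_mul_eq_of_integrable {f g : EuclideanSpace ℝ (Fin n) → ℂ}
    (hf : Integrable f) (hg : Integrable g) : ∫ x, 𝓕 g x * f x = ∫ x, g x * 𝓕 f x := by
  have := VectorFourier.integral_fourierIntegral_smul_eq_flip (μ := volume) (ν := volume)
    (L := innerₗ (EuclideanSpace ℝ (Fin n)))
    Real.continuous_fourierChar (by exact continuous_inner) hg hf
  rw [flip_innerₗ] at this
  exact this

/-- The abstract `L²` transform is compatible with that of tempered distributions, and the integral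
transform satisfies the same duality identity. Hence both have equal pairings with all smooth
compactly supported functions. -/
theorem fourier_toLp_two_ae_eq {f : EuclideanSpace ℝ (Fin n) → ℂ} (hf1 : Integrable f)
    (hf2 : MemLp f 2) : (𝓕 (hf2.toLp f) : Lp ℂ 2 (volume : Measure (EuclideanSpace ℝ (Fin n)))) =ᵐ[volume] 𝓕 f := by
  have hcont : Continuous (𝓕 f) :=
    VectorFourier.fourierIntegral_continuous Real.continuous_fourierChar
      (by exact continuous_inner) hf1
  have hL : LocallyIntegrable (𝓕 (hf2.toLp f) : Lp ℂ 2 (volume : Measure (EuclideanSpace ℝ (Fin n)))) volume :=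
    (Lp.memLp _).locallyIntegrable (by norm_num)
  refine ae_eq_of_integral_contDiff_smul_eq hL hcont.locallyIntegrable ?_
  intro g g_smooth g_cpt
  have hg₁ : HasCompactSupport (Complex.ofRealCLM ∘ g) := g_cpt.comp_left rfl
  have hg₂ : ContDiff ℝ ∞ (Complex.ofRealCLM ∘ g) := by fun_prop
  set G := hg₁.toSchwartzMap hg₂
  have key : (𝓕 (Lp.toTemperedDistribution (hf2.toLp f))) G = _ :=
    congrArg (fun T => T G) (Lp.fourier_toTemperedDistribution_eq (hf2.toLp f))
  rw [TemperedDistribution.fourier_apply, Lp.toTemperedDistribution_apply,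
    Lp.toTemperedDistribution_apply] at key
  have h1 : ∫ x, (𝓕 G : 𝓢(EuclideanSpace ℝ (Fin n), ℂ)) x • hf2.toLp f x =
      ∫ x, (𝓕 G : 𝓢(EuclideanSpace ℝ (Fin n), ℂ)) x * f x := by
    apply integral_congr_ae
    filter_upwards [hf2.coeFn_toLp] with x hx
    rw [hx, smul_eq_mul]
  rw [h1, SchwartzMap.fourier_coe, integral_fourier_mul_eq_of_integrable hf1 G.integrable] at key
  have hG : ∀ x, G x = (g x : ℂ) := fun x => rfl
  simp only [hG, smul_eq_mul] at key
  simp only [Complex.real_smul]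
  exact key.symm

theorem memLp_two_fourier {f : EuclideanSpace ℝ (Fin n) → ℂ} (hf1 : Integrable f)
    (hf2 : MemLp f 2) : MemLp (𝓕 f) 2 :=
  (memLp_congr_ae (fourier_toLp_two_ae_eq hf1 hf2)).1 (Lp.memLp _)

theorem eLpNorm_two_fourier {f : EuclideanSpace ℝ (Fin n) → ℂ} (hf1 : Integrable f)
    (hf2 : MemLp f 2) : eLpNorm (𝓕 f) 2 volume = eLpNorm f 2 volume := by
  rw [← eLpNorm_congr_ae (fourier_toLp_two_ae_eq hf1 hf2), ← eLpNorm_congr_ae hf2.coeFn_toLp,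
    ← Lp.enorm_def, ← Lp.enorm_def, ← ofReal_norm, ← ofReal_norm, Lp.norm_fourier_eq]

/-! ### The weighted Schur test. -/

/-- Cauchy–Schwarz for the factorization `w g = w^(1/2) · (w^(1/2) g)`. -/
theorem sq_lintegral_mul_le {α : Type*} [MeasurableSpace α] {μ : Measure α} {w g : α → ℝ≥0∞}
    (hw : AEMeasurable w μ) (hg : AEMeasurable g μ) :
    (∫⁻ x, w x * g x ∂μ) ^ 2 ≤ (∫⁻ x, w x ∂μ) * ∫⁻ x, w x * g x ^ 2 ∂μ := by
  have hsq : ∀ x : ℝ≥0∞, (x ^ (1 / 2 : ℝ)) ^ 2 = x := by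
    intro x
    rw [← ENNReal.rpow_natCast, ← ENNReal.rpow_mul]
    norm_num
  have h := ENNReal.lintegral_mul_le_Lp_mul_Lq μ Real.HolderConjugate.two_two
    (hw.pow_const (1 / 2 : ℝ)) ((hw.pow_const (1 / 2 : ℝ)).mul hg)
  have h1 : ∀ x, ((fun x => w x ^ (1 / 2 : ℝ)) * ((fun x => w x ^ (1 / 2 : ℝ)) * g)) x =
      w x * g x := by
    intro x
    simp only [Pi.mul_apply]
    rw [← mul_assoc, ← sq, hsq]
  simp only [Pi.mul_apply] at h h1
  simp only [h1, ENNReal.rpow_two, mul_pow, hsq] at h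
  calc (∫⁻ x, w x * g x ∂μ) ^ 2 ≤ _ := pow_le_pow_left' h 2
    _ = _ := by rw [mul_pow, hsq, hsq]

theorem lintegral_comp_smul_eq {c : ℝ} (hc : 0 < c) {h : EuclideanSpace ℝ (Fin n) → ℝ≥0∞}
    (hh : Measurable h) : ∫⁻ x, h (c • x) = ENNReal.ofReal ((c ^ n)⁻¹) * ∫⁻ x, h x := by
  have := Measure.map_addHaar_smul (volume : Measure (EuclideanSpace ℝ (Fin n))) hc.ne'
  rw [← lintegral_map hh (by fun_prop), this, lintegral_smul_measure, abs_of_pos (by positivity)]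
  simp

section Weight

variable {j : Fin n} {a b : ℝ} {m : EuclideanSpace ℝ (Fin n) → ℂ}

/-- The factor `(1 - t)⁻² ≥ 1` only weakens the first bound; it lets both marginals of the Schur
test share one majorant. -/
theorem norm_inv_mul_le_min (ha : 0 ≤ a)
    (h1 : ∀ η, ‖m η‖ ≤ 2 * Real.pi * |η j| * a) (h2 : ∀ η, 2 * Real.pi * |η j| * ‖m η‖ ≤ b)
    {t : ℝ} (ht : 0 < t) (ht1 : t < 1) {ξ : EuclideanSpace ℝ (Fin n)} (hξ : ξ j ≠ 0) :
    ‖(t⁻¹ : ℂ) * m (t • ξ)‖ ≤ min (2 * Real.pi * |ξ j| * a / (1 - t) ^ 2)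
      (b / (t ^ 2 * (2 * Real.pi * |ξ j|))) := by
  have hr : 0 < 2 * Real.pi * |ξ j| := by positivity
  have h1' := h1 (t • ξ)
  have h2' := h2 (t • ξ)
  simp only [PiLp.smul_apply, smul_eq_mul, abs_mul, abs_of_pos ht] at h1' h2'
  set r := 2 * Real.pi * |ξ j| with hrdef
  rw [norm_mul, norm_inv, Complex.norm_real, Real.norm_of_nonneg ht.le]
  have h1t : 0 < 1 - t := by linarith
  apply le_min
  · rw [le_div_iff₀ (by positivity)]
    have : t⁻¹ * ‖m (t • ξ)‖ ≤ r * a := by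
      rw [inv_mul_le_iff₀ ht]
      calc _ ≤ _ := h1'
        _ = t * (r * a) := by rw [hrdef]; ring
    calc t⁻¹ * ‖m (t • ξ)‖ * (1 - t) ^ 2 ≤ r * a * 1 := by
          gcongr
          exact pow_le_one₀ h1t.le (by linarith)
      _ = r * a := mul_one _
  · rw [le_div_iff₀ (by positivity)]
    calc t⁻¹ * ‖m (t • ξ)‖ * (t ^ 2 * r) = 2 * Real.pi * (t * |ξ j|) * ‖m (t • ξ)‖ := by
          rw [hrdef]; field_simp
      _ ≤ b := h2'

/-- One of the `n` Jacobian factors `(1 - t)⁻¹` is absorbed exactly, as `dt / (t (1 - t)) = ds / s`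
for `s = t / (1 - t)`. The other `n - 1` are at most `2` each because `t ≤ 1/2`. -/
theorem norm_inv_mul_comp_inv_smul_le_min
    (h1 : ∀ η, ‖m η‖ ≤ 2 * Real.pi * |η j| * a) (h2 : ∀ η, 2 * Real.pi * |η j| * ‖m η‖ ≤ b)
    {t : ℝ} (ht : 0 < t) (ht1 : t ≤ 1 / 2) {η : EuclideanSpace ℝ (Fin n)} (hη : η j ≠ 0) :
    ((1 - t) ^ n)⁻¹ * ‖(t⁻¹ : ℂ) * m (t • (1 - t)⁻¹ • η)‖ ≤
      2 ^ (n - 1) * min (2 * Real.pi * |η j| * a / (1 - t) ^ 2)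
      (b / (t ^ 2 * (2 * Real.pi * |η j|))) := by
  have hr : 0 < 2 * Real.pi * |η j| := by positivity
  have h1t : 0 < 1 - t := by linarith
  have h1' := h1 (t • (1 - t)⁻¹ • η)
  have h2' := h2 (t • (1 - t)⁻¹ • η)
  simp only [PiLp.smul_apply, smul_eq_mul, abs_mul, abs_of_pos ht, abs_inv,
    abs_of_pos h1t] at h1' h2'
  set r := 2 * Real.pi * |η j| with hrdef
  obtain ⟨k, rfl⟩ : ∃ k, n = k + 1 := ⟨n - 1, by have := j.pos; omega⟩
  rw [norm_mul, norm_inv, Complex.norm_real, Real.norm_of_nonneg ht.le, Nat.add_sub_cancel]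
  set N := ‖m (t • (1 - t)⁻¹ • η)‖ with hN
  have hk : ((1 - t) ^ k)⁻¹ ≤ 2 ^ k := by
    rw [← inv_pow]
    refine pow_le_pow_left₀ (by positivity) ?_ k
    rw [inv_le_comm₀ h1t (by norm_num)]
    linarith
  have hmin : (1 - t)⁻¹ * (t⁻¹ * N) ≤ min (r * a / (1 - t) ^ 2) (b / (t ^ 2 * r)) := by
    apply le_min
    · rw [le_div_iff₀ (by positivity)]
      calc (1 - t)⁻¹ * (t⁻¹ * N) * (1 - t) ^ 2 = (1 - t) * t⁻¹ * N := by field_simp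
        _ ≤ (1 - t) * t⁻¹ * (2 * Real.pi * (t * ((1 - t)⁻¹ * |η j|)) * a) := by gcongr
        _ = r * a := by rw [hrdef]; field_simp
    · rw [le_div_iff₀ (by positivity)]
      calc (1 - t)⁻¹ * (t⁻¹ * N) * (t ^ 2 * r) = 2 * Real.pi * (t * ((1 - t)⁻¹ * |η j|)) * N := by
            rw [hrdef]; field_simp
        _ ≤ b := h2'
  calc ((1 - t) ^ (k + 1))⁻¹ * (t⁻¹ * N) = ((1 - t) ^ k)⁻¹ * ((1 - t)⁻¹ * (t⁻¹ * N)) := by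
        rw [pow_succ, mul_inv]; ring
    _ ≤ 2 ^ k * min (r * a / (1 - t) ^ 2) (b / (t ^ 2 * r)) := by
        gcongr

theorem ae_apply_ne_zero (j : Fin n) : ∀ᵐ ξ : EuclideanSpace ℝ (Fin n), ξ j ≠ 0 := by
  have h := Measure.addHaar_submodule (volume : Measure (EuclideanSpace ℝ (Fin n)))
    (LinearMap.ker (EuclideanSpace.proj j : EuclideanSpace ℝ (Fin n) →L[ℝ] ℝ).toLinearMap) (by
      intro h
      have : EuclideanSpace.single j (1 : ℝ) ∈ (LinearMap.ker
        (EuclideanSpace.proj j : EuclideanSpace ℝ (Fin n) →L[ℝ] ℝ).toLinearMap) := by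
        rw [h]; trivial
      simp at this)
  rw [ae_iff]
  convert! h using 2
  ext ξ
  simp

theorem lintegral_weight_le (ha : 0 ≤ a) (hb : 0 ≤ b) {ρ : ℝ} (hρ : 0 < ρ)
    (h1 : ∀ η, ‖m η‖ ≤ 2 * Real.pi * |η j| * a) (h2 : ∀ η, 2 * Real.pi * |η j| * ‖m η‖ ≤ b)
    {ξ : EuclideanSpace ℝ (Fin n)} (hξ : ξ j ≠ 0) :
    ∫⁻ t in Ioc (0 : ℝ) (1 / 2), ‖(t⁻¹ : ℂ) * m (t • ξ)‖ₑ ≤ ENNReal.ofReal (ρ⁻¹ * a + ρ * b) := by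
  have hr : 0 < 2 * Real.pi * |ξ j| := by positivity
  refine le_trans ?_ (lintegral_Ioc_min_le ha hb hr hρ)
  refine le_trans ?_ (lintegral_mono_set (Ioc_subset_Ioc_right (by norm_num : (1 / 2 : ℝ) ≤ 1)))
  refine setLIntegral_mono' measurableSet_Ioc fun t ht => ?_
  rw [← ofReal_norm]
  exact ENNReal.ofReal_le_ofReal
    (norm_inv_mul_le_min ha h1 h2 ht.1 (ht.2.trans_lt (by norm_num)) hξ)

theorem lintegral_dilated_weight_le (ha : 0 ≤ a) (hb : 0 ≤ b) {ρ : ℝ} (hρ : 0 < ρ)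
    (h1 : ∀ η, ‖m η‖ ≤ 2 * Real.pi * |η j| * a) (h2 : ∀ η, 2 * Real.pi * |η j| * ‖m η‖ ≤ b)
    {η : EuclideanSpace ℝ (Fin n)} (hη : η j ≠ 0) :
    ∫⁻ t in Ioc (0 : ℝ) (1 / 2), ENNReal.ofReal (((1 - t) ^ n)⁻¹) *
        ‖(t⁻¹ : ℂ) * m (t • (1 - t)⁻¹ • η)‖ₑ ≤
      2 ^ (n - 1) * ENNReal.ofReal (ρ⁻¹ * a + ρ * b) := by
  have hr : 0 < 2 * Real.pi * |η j| := by positivity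
  refine le_trans ?_ (mul_le_mul_right (lintegral_Ioc_min_le ha hb hr hρ) _)
  rw [← lintegral_const_mul' _ _ (by finiteness)]
  refine le_trans ?_ (lintegral_mono_set (Ioc_subset_Ioc_right (by norm_num : (1 / 2 : ℝ) ≤ 1)))
  refine setLIntegral_mono' measurableSet_Ioc fun t ht => ?_
  have h1t : 0 < 1 - t := by linarith [ht.2]
  rw [← ofReal_norm, ← ENNReal.ofReal_mul (by positivity)]
  refine (ENNReal.ofReal_le_ofReal
    (norm_inv_mul_comp_inv_smul_le_min h1 h2 ht.1 ht.2 hη)).trans (le_of_eq ?_)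
  rw [ENNReal.ofReal_mul (by positivity), ENNReal.ofReal_pow (by norm_num)]
  simp

/-- Schur test: Cauchy–Schwarz in `t` uses up one marginal of the weight; Tonelli and the dilation
`η = (1 - t) ξ` expose the other. -/
theorem lintegral_sq_lintegral_le (hm : Continuous m) {F : EuclideanSpace ℝ (Fin n) → ℂ}
    (hF : Continuous F) (ha : 0 ≤ a) (hb : 0 ≤ b) {ρ : ℝ} (hρ : 0 < ρ)
    (h1 : ∀ η, ‖m η‖ ≤ 2 * Real.pi * |η j| * a)
    (h2 : ∀ η, 2 * Real.pi * |η j| * ‖m η‖ ≤ b) :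
    ∫⁻ ξ, (∫⁻ t in Ioc (0 : ℝ) (1 / 2), ‖(t⁻¹ : ℂ) * m (t • ξ) * F ((1 - t) • ξ)‖ₑ) ^ 2 ≤
      2 ^ (n - 1) * ENNReal.ofReal (ρ⁻¹ * a + ρ * b) ^ 2 * ∫⁻ η, ‖F η‖ₑ ^ 2 := by
  have hmm := hm.measurable
  have hFm := hF.measurable
  have hof := Complex.measurable_ofReal
  set C := ENNReal.ofReal (ρ⁻¹ * a + ρ * b)
  calc ∫⁻ ξ, (∫⁻ t in Ioc (0 : ℝ) (1 / 2), ‖(t⁻¹ : ℂ) * m (t • ξ) * F ((1 - t) • ξ)‖ₑ) ^ 2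
      ≤ ∫⁻ ξ, C * ∫⁻ t in Ioc (0 : ℝ) (1 / 2),
          ‖(t⁻¹ : ℂ) * m (t • ξ)‖ₑ * ‖F ((1 - t) • ξ)‖ₑ ^ 2 := by
        apply lintegral_mono_ae
        filter_upwards [ae_apply_ne_zero j] with ξ hξ
        simp only [enorm_mul _ (F _)]
        refine (sq_lintegral_mul_le (by fun_prop) (by fun_prop)).trans ?_
        gcongr
        exact lintegral_weight_le ha hb hρ h1 h2 hξ
    _ = C * ∫⁻ t in Ioc (0 : ℝ) (1 / 2), ∫⁻ ξ,
          ‖(t⁻¹ : ℂ) * m (t • ξ)‖ₑ * ‖F ((1 - t) • ξ)‖ₑ ^ 2 := by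
        rw [lintegral_const_mul' _ _ (by finiteness), lintegral_lintegral_swap]
        exact Measurable.aemeasurable (by fun_prop)
    _ = C * ∫⁻ t in Ioc (0 : ℝ) (1 / 2), ∫⁻ η, ENNReal.ofReal (((1 - t) ^ n)⁻¹) *
          ‖(t⁻¹ : ℂ) * m (t • (1 - t)⁻¹ • η)‖ₑ * ‖F η‖ₑ ^ 2 := by
        congr 1
        refine setLIntegral_congr_fun measurableSet_Ioc fun t ht => ?_
        have h1t : 0 < 1 - t := by linarith [ht.2]
        -- The function `h` is the integrand in the variable `η = (1 - t) ξ`, so `tξ` reads `t (1 -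
        -- t)⁻¹ η`.
        have := lintegral_comp_smul_eq h1t
          (h := fun η => ‖(t⁻¹ : ℂ) * m (t • (1 - t)⁻¹ • η)‖ₑ * ‖F η‖ₑ ^ 2) (by fun_prop)
        simp only [inv_smul_smul₀ h1t.ne'] at this
        simp only [mul_assoc]
        rw [this, lintegral_const_mul' _ _ (by finiteness)]
    _ = C * ∫⁻ η, (∫⁻ t in Ioc (0 : ℝ) (1 / 2), ENNReal.ofReal (((1 - t) ^ n)⁻¹) *
          ‖(t⁻¹ : ℂ) * m (t • (1 - t)⁻¹ • η)‖ₑ) * ‖F η‖ₑ ^ 2 := by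
        rw [lintegral_lintegral_swap (Measurable.aemeasurable (by fun_prop))]
        congr 1
        refine lintegral_congr fun η => ?_
        rw [lintegral_mul_const' _ _ (by finiteness)]
    _ ≤ C * ∫⁻ η, (2 ^ (n - 1) * C) * ‖F η‖ₑ ^ 2 := by
        gcongr 1
        apply lintegral_mono_ae
        filter_upwards [ae_apply_ne_zero j] with η hη
        gcongr
        exact lintegral_dilated_weight_le ha hb hρ h1 h2 hη
    _ = _ := by
        rw [lintegral_const_mul' _ _ (by finiteness)]
        ring

end Weight

/-! ### The kernel and its affine changes of variable. -/

theorem continuous_partialDeriv {φ : EuclideanSpace ℝ (Fin n) → ℂ} (hφ : ContDiff ℝ ∞ φ)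
    (j : Fin n) : Continuous (partialDeriv j φ) := by
  have : partialDeriv j φ = fun x => fderiv ℝ φ x (EuclideanSpace.single j 1) := by
    ext x
    exact (hφ.differentiable (by simp) x).lineDeriv_eq_fderiv
  rw [this]
  exact (hφ.continuous_fderiv (by simp)).clm_apply continuous_const

theorem singularIntegrand_eq {φ : EuclideanSpace ℝ (Fin n) → ℂ} (hφ : Differentiable ℝ φ)
    (j : Fin n) (f : EuclideanSpace ℝ (Fin n) → ℂ) (x : EuclideanSpace ℝ (Fin n)) (t : ℝ)
    (y : EuclideanSpace ℝ (Fin n)) :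
    singularIntegrand φ j f x t y =
      (t⁻¹ : ℂ) * partialDeriv j φ (t⁻¹ • x + (1 - t⁻¹) • y) * f y * ((t ^ n)⁻¹ : ℝ) := by
  have harg : ∀ z, y + t⁻¹ • (z - y) = t⁻¹ • z + (1 - t⁻¹) • y := by
    intro z
    module
  have hd : HasFDerivAt (fun z => φ (t⁻¹ • z + (1 - t⁻¹) • y))
      ((fderiv ℝ φ (t⁻¹ • x + (1 - t⁻¹) • y)).comp
        (t⁻¹ • ContinuousLinearMap.id ℝ (EuclideanSpace ℝ (Fin n)))) x :=
    (hφ _).hasFDerivAt.comp x (((hasFDerivAt_id x).const_smul t⁻¹).add_const _)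
  rw [singularIntegrand]
  congr 2
  simp only [harg]
  rw [partialDeriv, partialDeriv, hd.differentiableAt.lineDeriv_eq_fderiv, hd.fderiv,
    (hφ _).lineDeriv_eq_fderiv]
  simp

theorem integral_comp_inv_smul_add {F : Type*} [NormedAddCommGroup F] [NormedSpace ℝ F]
    (h : EuclideanSpace ℝ (Fin n) → F) (c : EuclideanSpace ℝ (Fin n)) {t : ℝ} (ht : 0 < t) :
    ∫ x, h (t⁻¹ • x + c) = t ^ n • ∫ x, h x := by
  rw [Measure.integral_comp_smul volume (fun z => h (z + c)) t⁻¹, integral_add_right_eq_self h c]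
  simp [abs_of_pos ht]

theorem integrable_comp_inv_smul_add {F : Type*} [NormedAddCommGroup F]
    {h : EuclideanSpace ℝ (Fin n) → F} (hh : Integrable h) (c : EuclideanSpace ℝ (Fin n)) {t : ℝ}
    (ht : 0 < t) : Integrable fun x => h (t⁻¹ • x + c) :=
  (integrable_comp_smul_iff volume (fun z => h (z + c)) (inv_pos.2 ht).ne').2
    (hh.comp_add_right c)

theorem fourier_comp_inv_smul_add (ψ : EuclideanSpace ℝ (Fin n) → ℂ)
    (c ξ : EuclideanSpace ℝ (Fin n)) {t : ℝ} (ht : 0 < t) :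
    𝓕 (fun x => ψ (t⁻¹ • x + c)) ξ =
      (t ^ n : ℝ) • Real.fourierChar (inner ℝ (t • c) ξ) • 𝓕 ψ (t • ξ) := by
  have h := integral_comp_inv_smul_add
    (fun z => Real.fourierChar (-(inner ℝ (t • (z - c)) ξ)) • ψ z) c ht
  simp only [add_sub_cancel_right, smul_inv_smul₀ ht.ne'] at h
  rw [Real.fourier_eq, h, Real.fourier_eq]
  congr 1
  rw [Circle.smul_def, ← integral_smul]
  refine integral_congr_ae (Eventually.of_forall fun z => ?_)
  simp only
  rw [← Circle.smul_def, smul_smul, ← AddChar.map_add_eq_mul]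
  congr 2
  simp only [smul_sub, inner_sub_left, inner_smul_left, inner_smul_right, conj_trivial]
  ring

/-! ### Shells `a < t ≤ b` with `a > 0`: integrability, bounds, Fourier transform. -/

section Shell

variable {φ : EuclideanSpace ℝ (Fin n) → ℂ} {j : Fin n} {f : EuclideanSpace ℝ (Fin n) → ℂ}
  {a b : ℝ}

/-- The part of the singular integral over the shell `a < t ≤ b`. -/
noncomputable def shellOp (φ : EuclideanSpace ℝ (Fin n) → ℂ) (j : Fin n) (f : EuclideanSpace ℝ (Fin n) → ℂ)
    (a b : ℝ) (x : EuclideanSpace ℝ (Fin n)) : ℂ :=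
  ∫ p : ℝ × EuclideanSpace ℝ (Fin n), singularIntegrand φ j f x p.1 p.2
    ∂((volume.restrict (Ioc a b)).prod volume)

theorem aestronglyMeasurable_singularIntegrand (hφ : ContDiff ℝ ∞ φ)
    (hf : AEStronglyMeasurable f) (x : EuclideanSpace ℝ (Fin n)) :
    AEStronglyMeasurable
      (fun p : ℝ × EuclideanSpace ℝ (Fin n) => singularIntegrand φ j f x p.1 p.2)
      ((volume.restrict (Ioc a b)).prod volume) := by
  simp only [singularIntegrand_eq (hφ.differentiable (by simp))]
  have hψ := (continuous_partialDeriv hφ j).measurable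
  have hof := Complex.measurable_ofReal
  refine AEStronglyMeasurable.mul (AEStronglyMeasurable.mul ?_ hf.comp_snd) ?_
  · exact Measurable.aestronglyMeasurable (by fun_prop)
  · exact Measurable.aestronglyMeasurable (by fun_prop)

theorem aestronglyMeasurable_singularIntegrand_prod (hφ : ContDiff ℝ ∞ φ)
    (hf : AEStronglyMeasurable f) :
    AEStronglyMeasurable
      (fun q : (ℝ × EuclideanSpace ℝ (Fin n)) × EuclideanSpace ℝ (Fin n) =>
        singularIntegrand φ j f q.2 q.1.1 q.1.2)
      (((volume.restrict (Ioc a b)).prod volume).prod volume) := by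
  simp only [singularIntegrand_eq (hφ.differentiable (by simp))]
  have hψ := (continuous_partialDeriv hφ j).measurable
  have hof := Complex.measurable_ofReal
  refine AEStronglyMeasurable.mul (AEStronglyMeasurable.mul ?_ ?_) ?_
  · exact Measurable.aestronglyMeasurable (by fun_prop)
  · exact (hf.comp_snd (μ := volume.restrict (Ioc a b))).comp_fst
  · exact Measurable.aestronglyMeasurable (by fun_prop)

theorem ae_prod_fst_mem :
    ∀ᵐ p : ℝ × EuclideanSpace ℝ (Fin n) ∂((volume.restrict (Ioc a b)).prod volume),
      p.1 ∈ Ioc a b :=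
  Measure.quasiMeasurePreserving_fst.ae (ae_restrict_mem measurableSet_Ioc)

theorem norm_singularIntegrand_le (hφ : Differentiable ℝ φ) {M : ℝ}
    (hM : ∀ z, ‖partialDeriv j φ z‖ ≤ M) (ha : 0 < a) {t : ℝ} (ht : a ≤ t)
    (x y : EuclideanSpace ℝ (Fin n)) :
    ‖singularIntegrand φ j f x t y‖ ≤ (a ^ (n + 1))⁻¹ * M * ‖f y‖ := by
  have ht0 : 0 < t := ha.trans_le ht
  have hM0 : 0 ≤ M := (norm_nonneg _).trans (hM 0)
  rw [singularIntegrand_eq hφ]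
  simp only [norm_mul, norm_inv, Complex.norm_real, norm_pow, Real.norm_of_nonneg ht0.le]
  calc t⁻¹ * ‖partialDeriv j φ (t⁻¹ • x + (1 - t⁻¹) • y)‖ * ‖f y‖ * (t ^ n)⁻¹
      ≤ a⁻¹ * M * ‖f y‖ * (a ^ n)⁻¹ := by
        gcongr
        exact hM _
    _ = _ := by
        rw [pow_succ, mul_inv]
        ring

theorem integrable_singularIntegrand (hφ : ContDiff ℝ ∞ φ) {M : ℝ}
    (hM : ∀ z, ‖partialDeriv j φ z‖ ≤ M) (hf : Integrable f) (ha : 0 < a)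
    (x : EuclideanSpace ℝ (Fin n)) :
    Integrable (fun p : ℝ × EuclideanSpace ℝ (Fin n) => singularIntegrand φ j f x p.1 p.2)
      ((volume.restrict (Ioc a b)).prod volume) := by
  have h : Integrable (fun p : ℝ × EuclideanSpace ℝ (Fin n) =>
      ((a ^ (n + 1))⁻¹ * M) * ‖f p.2‖) ((volume.restrict (Ioc a b)).prod volume) :=
    (integrable_const ((a ^ (n + 1))⁻¹ * M)).mul_prod hf.norm
  refine h.mono' (aestronglyMeasurable_singularIntegrand hφ hf.aestronglyMeasurable x) ?_
  filter_upwards [ae_prod_fst_mem] with p hp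
  exact norm_singularIntegrand_le (hφ.differentiable (by simp)) hM ha hp.1.le x p.2

theorem norm_shellOp_le (hφ : ContDiff ℝ ∞ φ) {M : ℝ}
    (hM : ∀ z, ‖partialDeriv j φ z‖ ≤ M) (hf : Integrable f) (ha : 0 < a) (hab : a ≤ b)
    (x : EuclideanSpace ℝ (Fin n)) :
    ‖shellOp φ j f a b x‖ ≤ (b - a) * ((a ^ (n + 1))⁻¹ * M) * ∫ y, ‖f y‖ := by
  have h : Integrable (fun p : ℝ × EuclideanSpace ℝ (Fin n) =>
      ((a ^ (n + 1))⁻¹ * M) * ‖f p.2‖) ((volume.restrict (Ioc a b)).prod volume) :=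
    (integrable_const ((a ^ (n + 1))⁻¹ * M)).mul_prod hf.norm
  calc ‖shellOp φ j f a b x‖
      ≤ ∫ p : ℝ × EuclideanSpace ℝ (Fin n), ((a ^ (n + 1))⁻¹ * M) * ‖f p.2‖
          ∂((volume.restrict (Ioc a b)).prod volume) := by
        refine norm_integral_le_of_norm_le h ?_
        filter_upwards [ae_prod_fst_mem] with p hp
        exact norm_singularIntegrand_le (hφ.differentiable (by simp)) hM ha hp.1.le x p.2
    _ = _ := by
        rw [integral_prod_mul (μ := volume.restrict (Ioc a b)) (ν := volume)
          (fun _ : ℝ => (a ^ (n + 1))⁻¹ * M) (fun y => ‖f y‖)]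
        simp [hab]

/-- Integrating in `x` first yields `t^n ‖∂_jφ‖₁`, which cancels `t⁻ⁿ` and leaves `t⁻¹`, integrable
away from `0`. -/
theorem integrable_singularIntegrand_prod (hφ : ContDiff ℝ ∞ φ)
    (hψ : Integrable (partialDeriv j φ)) (hf : Integrable f) (ha : 0 < a) :
    Integrable (fun q : (ℝ × EuclideanSpace ℝ (Fin n)) × EuclideanSpace ℝ (Fin n) =>
        singularIntegrand φ j f q.2 q.1.1 q.1.2)
      (((volume.restrict (Ioc a b)).prod volume).prod volume) := by
  have hd : Differentiable ℝ φ := hφ.differentiable (by simp)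
  rw [integrable_prod_iff
    (aestronglyMeasurable_singularIntegrand_prod hφ hf.aestronglyMeasurable)]
  constructor
  · filter_upwards [ae_prod_fst_mem] with p hp
    simp only [singularIntegrand_eq hd]
    exact (((integrable_comp_inv_smul_add hψ _ (ha.trans hp.1)).const_mul _).mul_const _).mul_const _
  · have hinv : Integrable (fun t : ℝ => t⁻¹) (volume.restrict (Ioc a b)) := by
      refine (continuousOn_of_forall_continuousAt fun t ht => ?_ :
        ContinuousOn (fun t : ℝ => t⁻¹) (Icc a b)).integrableOn_Icc.mono_set Ioc_subset_Icc_self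
      exact continuousAt_inv₀ (ha.trans_le ht.1).ne'
    refine (hinv.mul_prod (hf.norm.const_mul (∫ z, ‖partialDeriv j φ z‖))).congr ?_
    filter_upwards [ae_prod_fst_mem] with p hp
    have ht : 0 < p.1 := ha.trans hp.1
    simp only [singularIntegrand_eq hd, norm_mul, norm_inv, Complex.norm_real, norm_pow,
      Real.norm_of_nonneg ht.le, integral_mul_const, integral_const_mul]
    rw [integral_comp_inv_smul_add (fun z => ‖partialDeriv j φ z‖) _ ht, smul_eq_mul]
    field_simp

theorem integrable_shellOp (hφ : ContDiff ℝ ∞ φ)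
    (hψ : Integrable (partialDeriv j φ)) (hf : Integrable f) (ha : 0 < a) :
    Integrable (shellOp φ j f a b) :=
  (integrable_singularIntegrand_prod hφ hψ hf ha).integral_prod_right

/-- By Fubini the `x`-transform is taken first. It gives `m(tξ)` times a phase in `y`, and that
phase turns the `y`-integral of `f` into its transform at `(1 - t) ξ`. -/
theorem fourier_shellOp (hφ : ContDiff ℝ ∞ φ)
    (hψ : Integrable (partialDeriv j φ)) (hf : Integrable f) (ha : 0 < a)
    (ξ : EuclideanSpace ℝ (Fin n)) :
    𝓕 (shellOp φ j f a b) ξ =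
      ∫ t in Ioc a b, (t⁻¹ : ℂ) * 𝓕 (partialDeriv j φ) (t • ξ) * 𝓕 f ((1 - t) • ξ) := by
  have hd : Differentiable ℝ φ := hφ.differentiable (by simp)
  have hI := integrable_singularIntegrand_prod (b := b) hφ hψ hf ha
  have hI' : Integrable (fun q : (ℝ × EuclideanSpace ℝ (Fin n)) × EuclideanSpace ℝ (Fin n) =>
      Real.fourierChar (-(inner ℝ q.2 ξ)) • singularIntegrand φ j f q.2 q.1.1 q.1.2)
      (((volume.restrict (Ioc a b)).prod volume).prod volume) := by
    refine hI.norm.mono' ?_ (Eventually.of_forall fun q => ?_)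
    · refine AEStronglyMeasurable.smul (f := fun q : (ℝ × EuclideanSpace ℝ (Fin n)) ×
        EuclideanSpace ℝ (Fin n) => Real.fourierChar (-(inner ℝ q.2 ξ))) ?_ hI.aestronglyMeasurable
      have := Real.continuous_fourierChar
      exact Continuous.aestronglyMeasurable (by fun_prop)
    · rw [Circle.norm_smul]
  have hx : ∀ᵐ p : ℝ × EuclideanSpace ℝ (Fin n) ∂((volume.restrict (Ioc a b)).prod volume),
      ∫ x, Real.fourierChar (-(inner ℝ x ξ)) • singularIntegrand φ j f x p.1 p.2 =
      (p.1⁻¹ : ℂ) * 𝓕 (partialDeriv j φ) (p.1 • ξ) *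
        (Real.fourierChar (-(inner ℝ p.2 ((1 - p.1) • ξ))) • f p.2) := by
    filter_upwards [ae_prod_fst_mem] with p hp
    have ht : 0 < p.1 := ha.trans hp.1
    have h := fourier_comp_inv_smul_add (partialDeriv j φ) ((1 - p.1⁻¹) • p.2) ξ ht
    rw [Real.fourier_eq] at h
    -- Here `t (1 - t⁻¹) = -(1 - t)` identifies the frequency seen by `f`.
    have e : inner ℝ (p.1 • (1 - p.1⁻¹) • p.2) ξ = -(inner ℝ p.2 ((1 - p.1) • ξ)) := by
      simp only [inner_smul_left, inner_smul_right, conj_trivial]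
      field_simp
      ring
    rw [e] at h
    simp only [singularIntegrand_eq hd, Circle.smul_def, smul_eq_mul, Complex.real_smul] at h ⊢
    have h2 : ∀ x : EuclideanSpace ℝ (Fin n), (Real.fourierChar (-(inner ℝ x ξ)) : ℂ) *
        ((p.1⁻¹ : ℂ) * partialDeriv j φ (p.1⁻¹ • x + (1 - p.1⁻¹) • p.2) * f p.2 *
          ((p.1 ^ n)⁻¹ : ℝ)) = ((p.1⁻¹ : ℂ) * f p.2 * ((p.1 ^ n)⁻¹ : ℝ)) *
          ((Real.fourierChar (-(inner ℝ x ξ)) : ℂ) *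
            partialDeriv j φ (p.1⁻¹ • x + (1 - p.1⁻¹) • p.2)) := fun x => by ring
    simp only [h2]
    rw [integral_const_mul, h]
    have : (p.1 : ℂ) ≠ 0 := by exact_mod_cast ht.ne'
    push_cast
    field_simp
  rw [Real.fourier_eq]
  calc ∫ x, Real.fourierChar (-(inner ℝ x ξ)) • shellOp φ j f a b x
      = ∫ x, ∫ p : ℝ × EuclideanSpace ℝ (Fin n),
          Real.fourierChar (-(inner ℝ x ξ)) • singularIntegrand φ j f x p.1 p.2
          ∂((volume.restrict (Ioc a b)).prod volume) := by
        simp only [shellOp, Circle.smul_def, integral_smul]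
    _ = ∫ p : ℝ × EuclideanSpace ℝ (Fin n), (∫ x,
          Real.fourierChar (-(inner ℝ x ξ)) • singularIntegrand φ j f x p.1 p.2)
          ∂((volume.restrict (Ioc a b)).prod volume) := (integral_integral_swap hI').symm
    _ = ∫ p : ℝ × EuclideanSpace ℝ (Fin n), (p.1⁻¹ : ℂ) * 𝓕 (partialDeriv j φ) (p.1 • ξ) *
        (Real.fourierChar (-(inner ℝ p.2 ((1 - p.1) • ξ))) • f p.2)
          ∂((volume.restrict (Ioc a b)).prod volume) := integral_congr_ae hx
    _ = _ := by
        rw [integral_prod _ (hI'.integral_prod_left.congr hx)]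
        simp only [integral_const_mul, ← Real.fourier_eq]

theorem truncatedOp_eq_shellOp (hφ : ContDiff ℝ ∞ φ) {M : ℝ}
    (hM : ∀ z, ‖partialDeriv j φ z‖ ≤ M) (hf : Integrable f) {ε : ℝ} (hε : 0 < ε) (hε1 : ε ≤ 1) :
    truncatedOp φ j ε f = shellOp φ j f ε 1 := by
  ext x
  rw [truncatedOp, shellOp, integral_prod _ (integrable_singularIntegrand hφ hM hf hε x),
    intervalIntegral.integral_of_le hε1]

theorem shellOp_add_shellOp (hφ : ContDiff ℝ ∞ φ) {M : ℝ}
    (hM : ∀ z, ‖partialDeriv j φ z‖ ≤ M) (hf : Integrable f) {c : ℝ} (ha : 0 < a) (hab : a ≤ b)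
    (hbc : b ≤ c) (x : EuclideanSpace ℝ (Fin n)) :
    shellOp φ j f a b x + shellOp φ j f b c x = shellOp φ j f a c x := by
  simp only [shellOp]
  rw [integral_prod _ (integrable_singularIntegrand hφ hM hf ha x),
    integral_prod _ (integrable_singularIntegrand hφ hM hf (ha.trans_le hab) x),
    integral_prod _ (integrable_singularIntegrand hφ hM hf ha x),
    ← Ioc_union_Ioc_eq_Ioc hab hbc, setIntegral_union (Ioc_disjoint_Ioc_of_le le_rfl)
      measurableSet_Ioc]
  · exact (integrable_singularIntegrand hφ hM hf ha x).integral_prod_left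
  · exact (integrable_singularIntegrand hφ hM hf (ha.trans_le hab) x).integral_prod_left

end Shell

/-! ### The symbols as the truncation tends to zero. -/

theorem eLpNorm_two_sq_eq_lintegral {α F : Type*} [MeasurableSpace α] {μ : Measure α}
    [NormedAddCommGroup F] (f : α → F) : eLpNorm f 2 μ ^ 2 = ∫⁻ x, ‖f x‖ₑ ^ 2 ∂μ := by
  have h := eLpNorm_nnreal_pow_eq_lintegral (μ := μ) (f := f) (p := 2) two_ne_zero
  simp only [NNReal.coe_ofNat, ENNReal.coe_ofNat, ENNReal.rpow_two] at h
  exact h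

section Symbol

/-- The Fourier transform of the part of the singular integral over the shell `a < t ≤ b`, for
`m` the Fourier transform of `∂φ/∂x_j` and `F` that of `f`. -/
noncomputable def shellSymbol (m F : EuclideanSpace ℝ (Fin n) → ℂ) (a b : ℝ)
    (ξ : EuclideanSpace ℝ (Fin n)) : ℂ :=
  ∫ t in Ioc a b, (t⁻¹ : ℂ) * m (t • ξ) * F ((1 - t) • ξ)

/-- The pointwise majorant of `shellSymbol m F a (1 / 2)`, `0 ≤ a`. -/
noncomputable def symbolMajorant (m F : EuclideanSpace ℝ (Fin n) → ℂ)
    (ξ : EuclideanSpace ℝ (Fin n)) : ℝ≥0∞ :=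
  ∫⁻ t in Ioc (0 : ℝ) (1 / 2), ‖(t⁻¹ : ℂ) * m (t • ξ) * F ((1 - t) • ξ)‖ₑ

variable {j : Fin n} {a b ρ : ℝ} {m F : EuclideanSpace ℝ (Fin n) → ℂ}

theorem measurable_symbolMajorant (hm : Continuous m) (hF : Continuous F) :
    Measurable (symbolMajorant m F) := by
  have hmm := hm.measurable
  have hFm := hF.measurable
  have hof := Complex.measurable_ofReal
  exact Measurable.lintegral_prod_right'
    (f := fun p : EuclideanSpace ℝ (Fin n) × ℝ =>
      ‖(p.2⁻¹ : ℂ) * m (p.2 • p.1) * F ((1 - p.2) • p.1)‖ₑ) (by fun_prop)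

theorem stronglyMeasurable_shellSymbol (hm : Continuous m) (hF : Continuous F) (a b : ℝ) :
    StronglyMeasurable (shellSymbol m F a b) := by
  have hmm := hm.measurable
  have hFm := hF.measurable
  have hof := Complex.measurable_ofReal
  refine StronglyMeasurable.integral_prod_right'
    (f := fun p : EuclideanSpace ℝ (Fin n) × ℝ =>
      (p.2⁻¹ : ℂ) * m (p.2 • p.1) * F ((1 - p.2) • p.1)) ?_
  exact Measurable.stronglyMeasurable (by fun_prop)

theorem enorm_shellSymbol_le (ha : 0 ≤ a) (ξ : EuclideanSpace ℝ (Fin n)) :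
    ‖shellSymbol m F a (1 / 2) ξ‖ₑ ≤ symbolMajorant m F ξ :=
  (enorm_integral_le_lintegral_enorm _).trans (lintegral_mono_set (Ioc_subset_Ioc_left ha))

/-- Finiteness of the majorant at `ξ` is absolute integrability in `t` down to `0`, so the primitive
is continuous at its lower endpoint. -/
theorem tendsto_shellSymbol (hm : Continuous m) (hF : Continuous F)
    {ξ : EuclideanSpace ℝ (Fin n)} (hξ : symbolMajorant m F ξ < ⊤) :
    Tendsto (fun ε => shellSymbol m F ε (1 / 2) ξ) (𝓝[>] 0) (𝓝 (shellSymbol m F 0 (1 / 2) ξ)) := by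
  have hmm := hm.measurable
  have hFm := hF.measurable
  have hof := Complex.measurable_ofReal
  have hI : IntegrableOn (fun t : ℝ => (t⁻¹ : ℂ) * m (t • ξ) * F ((1 - t) • ξ))
      (uIcc 0 (1 / 2)) := by
    rw [uIcc_of_le (by norm_num), integrableOn_Icc_iff_integrableOn_Ioc]
    exact ⟨Measurable.aestronglyMeasurable (by fun_prop), hξ⟩
  have h := intervalIntegral.continuousOn_primitive_interval_left hI 0 left_mem_uIcc
  have h' := (h.tendsto.mono_left (nhdsWithin_mono 0
    (uIcc_of_le (by norm_num : (0 : ℝ) ≤ 1 / 2) ▸ Ioc_subset_Icc_self)))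
  rw [nhdsWithin_Ioc_eq_nhdsGT (by norm_num : (0 : ℝ) < 1 / 2),
    intervalIntegral.integral_of_le (by norm_num)] at h'
  refine h'.congr' ?_
  filter_upwards [Ioc_mem_nhdsGT (by norm_num : (0 : ℝ) < 1 / 2)] with ε hε
  rw [intervalIntegral.integral_of_le hε.2, shellSymbol]

theorem eLpNorm_symbolMajorant_le (hm : Continuous m) (hF : Continuous F)
    (ha : 0 ≤ a) (hb : 0 ≤ b) (hρ : 0 < ρ)
    (h1 : ∀ η, ‖m η‖ ≤ 2 * Real.pi * |η j| * a) (h2 : ∀ η, 2 * Real.pi * |η j| * ‖m η‖ ≤ b) :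
    (∫⁻ ξ, symbolMajorant m F ξ ^ 2) ≤
      (ENNReal.ofReal ((2 : ℝ) ^ (((n : ℝ) - 1) / 2) * (ρ⁻¹ * a + ρ * b)) *
        eLpNorm F 2 volume) ^ 2 := by
  refine (lintegral_sq_lintegral_le hm hF ha hb hρ h1 h2).trans (le_of_eq ?_)
  rw [mul_pow, eLpNorm_two_sq_eq_lintegral, ENNReal.ofReal_mul (by positivity), mul_pow]
  congr 2
  rw [← ENNReal.ofReal_pow (by positivity), ← Real.rpow_natCast, ← Real.rpow_mul (by norm_num)]
  -- Truncated subtraction is harmless: the index `j` forces `n ≥ 1`.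
  have hn : ((n : ℝ) - 1) / 2 * ((2 : ℕ) : ℝ) = ((n - 1 : ℕ) : ℝ) := by
    rw [Nat.cast_sub j.pos]
    push_cast
    ring
  rw [hn, Real.rpow_natCast, ENNReal.ofReal_pow (by norm_num)]
  simp

theorem ae_symbolMajorant_lt_top (hm : Continuous m) (hF : Continuous F)
    (hH : ∫⁻ ξ, symbolMajorant m F ξ ^ 2 ≠ ⊤) : ∀ᵐ ξ, symbolMajorant m F ξ < ⊤ := by
  filter_upwards [ae_lt_top ((measurable_symbolMajorant hm hF).pow_const 2) hH] with ξ hξ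
  simpa using hξ

theorem memLp_toReal_symbolMajorant (hm : Continuous m) (hF : Continuous F)
    (hH : ∫⁻ ξ, symbolMajorant m F ξ ^ 2 ≠ ⊤) :
    MemLp (fun ξ => (symbolMajorant m F ξ).toReal) 2 := by
  refine ⟨(measurable_symbolMajorant hm hF).ennreal_toReal.aestronglyMeasurable, ?_⟩
  have h : eLpNorm (fun ξ => (symbolMajorant m F ξ).toReal) 2 volume ^ 2 < ⊤ := by
    rw [eLpNorm_two_sq_eq_lintegral]
    refine lt_of_le_of_lt (lintegral_mono fun ξ => ?_) hH.lt_top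
    gcongr
    rw [Real.enorm_of_nonneg ENNReal.toReal_nonneg]
    exact ENNReal.ofReal_toReal_le
  simpa using h

theorem eLpNorm_shellSymbol_le (ha : 0 ≤ a) {K : ℝ≥0∞}
    (hH : ∫⁻ ξ, symbolMajorant m F ξ ^ 2 ≤ K ^ 2) :
    eLpNorm (shellSymbol m F a (1 / 2)) 2 volume ≤ K := by
  rw [← ENNReal.pow_le_pow_left_iff two_ne_zero, eLpNorm_two_sq_eq_lintegral]
  refine (lintegral_mono fun ξ => ?_).trans hH
  gcongr
  exact enorm_shellSymbol_le ha ξ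

/-- Dominated convergence with `|g|` times the majorant, a product of two `L²` functions. -/
theorem tendsto_integral_mul_shellSymbol (hm : Continuous m) (hF : Continuous F)
    (hH : ∫⁻ ξ, symbolMajorant m F ξ ^ 2 ≠ ⊤) (g : 𝓢(EuclideanSpace ℝ (Fin n), ℂ)) :
    Tendsto (fun ε => ∫ ξ, g ξ * shellSymbol m F ε (1 / 2) ξ) (𝓝[>] 0)
      (𝓝 (∫ ξ, g ξ * shellSymbol m F 0 (1 / 2) ξ)) := by
  refine tendsto_integral_filter_of_dominated_convergence
    (fun ξ => ‖g ξ‖ * (symbolMajorant m F ξ).toReal) ?_ ?_ ?_ ?_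
  · exact Eventually.of_forall fun ε => g.continuous.aestronglyMeasurable.mul
      (stronglyMeasurable_shellSymbol hm hF ε _).aestronglyMeasurable
  · filter_upwards [self_mem_nhdsWithin] with ε hε
    filter_upwards [ae_symbolMajorant_lt_top hm hF hH] with ξ hξ
    rw [norm_mul, ← toReal_enorm (shellSymbol m F ε (1 / 2) ξ)]
    gcongr
    · exact hξ.ne
    · exact enorm_shellSymbol_le (le_of_lt hε) ξ
  · exact (g.memLp 2 volume).norm.integrable_mul (memLp_toReal_symbolMajorant hm hF hH)
  · filter_upwards [ae_symbolMajorant_lt_top hm hF hH] with ξ hξ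
    exact (tendsto_shellSymbol hm hF hξ).const_mul _

end Symbol

/-! ### Tempered distributions and norm comparisons. -/

theorem exists_isGivenBy {p : ℝ≥0∞} (hp : 1 ≤ p) {u : EuclideanSpace ℝ (Fin n) → ℂ}
    (hu : MemLp u p) : ∃ U : 𝓢'(EuclideanSpace ℝ (Fin n), ℂ), IsGivenBy U u := by
  have : Fact (1 ≤ p) := ⟨hp⟩
  have hpq := ENNReal.HolderConjugate.inv_one_sub_inv' hp
  refine ⟨Lp.toTemperedDistribution (hu.toLp u), fun g => ⟨?_, ?_⟩⟩
  · have := hpq.symm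
    exact (g.memLp (1 - p⁻¹)⁻¹ volume).integrable_mul hu
  · rw [Lp.toTemperedDistribution_apply]
    apply integral_congr_ae
    filter_upwards [hu.coeFn_toLp] with x hx
    rw [hx, smul_eq_mul]

theorem integral_mul_eq_integral_fourierInv_mul_fourier {T : EuclideanSpace ℝ (Fin n) → ℂ}
    (hT : Integrable T) (g : 𝓢(EuclideanSpace ℝ (Fin n), ℂ)) :
    ∫ x, g x * T x = ∫ ξ, (𝓕⁻ g : 𝓢(EuclideanSpace ℝ (Fin n), ℂ)) ξ * 𝓕 T ξ := by
  rw [← integral_fourier_mul_eq_of_integrable hT (𝓕⁻ g : 𝓢(EuclideanSpace ℝ (Fin n), ℂ)).integrable,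
    ← SchwartzMap.fourier_coe, FourierTransform.fourier_fourierInv_eq]

theorem exists_fourierInv_of_memLp_two {G : EuclideanSpace ℝ (Fin n) → ℂ} (hG : MemLp G 2) :
    ∃ u : EuclideanSpace ℝ (Fin n) → ℂ, MemLp u 2 ∧ eLpNorm u 2 volume = eLpNorm G 2 volume ∧
      ∀ g : 𝓢(EuclideanSpace ℝ (Fin n), ℂ),
        ∫ x, g x * u x = ∫ ξ, (𝓕⁻ g : 𝓢(EuclideanSpace ℝ (Fin n), ℂ)) ξ * G ξ := by
  set v : Lp ℂ 2 (volume : Measure (EuclideanSpace ℝ (Fin n))) := 𝓕⁻ (hG.toLp G) with hv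
  have hFv : 𝓕 v = hG.toLp G := FourierTransform.fourier_fourierInv_eq _
  refine ⟨v, Lp.memLp v, ?_, fun g => ?_⟩
  · rw [← Lp.enorm_def, ← eLpNorm_congr_ae hG.coeFn_toLp, ← Lp.enorm_def, ← hFv, ← ofReal_norm,
      ← ofReal_norm, Lp.norm_fourier_eq]
  · have key : 𝓕⁻ (Lp.toTemperedDistribution (hG.toLp G)) g = Lp.toTemperedDistribution v g :=
      congrArg (fun T => T g) (Lp.fourierInv_toTemperedDistribution_eq (hG.toLp G))
    rw [TemperedDistribution.fourierInv_apply, Lp.toTemperedDistribution_apply,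
      Lp.toTemperedDistribution_apply] at key
    simp only [smul_eq_mul] at key
    rw [← key]
    apply integral_congr_ae
    filter_upwards [hG.coeFn_toLp] with x hx
    rw [hx]

theorem memLp_two_of_integrable_of_bounded {α : Type*} [MeasurableSpace α] {μ : Measure α}
    {f : α → ℂ} (hf : Integrable f μ) {B : ℝ} (hB : ∀ x, ‖f x‖ ≤ B) : MemLp f 2 μ := by
  rw [memLp_two_iff_integrable_sq_norm hf.aestronglyMeasurable]
  simp only [sq]
  exact hf.norm.bdd_mul hf.norm.aestronglyMeasurable
    (Eventually.of_forall fun x => by simpa using hB x)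

/-- By continuity the set where the essential bound fails is open; being null, it is empty. -/
theorem norm_le_lpNorm_top {g : EuclideanSpace ℝ (Fin n) → ℂ} (hg : Continuous g)
    (hgb : MemLp g ⊤) (x : EuclideanSpace ℝ (Fin n)) : ‖g x‖ ≤ lpNorm g ⊤ volume := by
  by_contra! h
  have hopen : IsOpen {y | lpNorm g ⊤ volume < ‖g y‖} := isOpen_lt continuous_const hg.norm
  have hzero : volume {y | lpNorm g ⊤ volume < ‖g y‖} = 0 := by
    simpa [ae_iff] using ae_le_lpNorm_exponent_top hgb
  have := hopen.eq_empty_of_measure_zero hzero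
  exact (Set.mem_empty_iff_false x).1 (this ▸ h)

section Bounds

variable {f : EuclideanSpace ℝ (Fin n) → ℂ} {Ω : Set (EuclideanSpace ℝ (Fin n))}

theorem integral_norm_le_sqrt_mul_lpNorm (hΩ : volume Ω ≠ ⊤)
    (hf : MemLp f 2) (hfΩ : ∀ᵐ x, x ∉ Ω → f x = 0) :
    ∫ x, ‖f x‖ ≤ √(volume.real Ω) * lpNorm f 2 (volume.restrict Ω) := by
  have : IsFiniteMeasure (volume.restrict Ω) := ⟨by simpa using hΩ.lt_top⟩
  have hfr : MemLp f 2 (volume.restrict Ω) := hf.restrict Ω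
  have h1 : ∫ x, ‖f x‖ = ∫ x in Ω, ‖f x‖ := by
    refine (setIntegral_eq_integral_of_ae_compl_eq_zero ?_).symm
    filter_upwards [hfΩ] with x hx hxΩ
    rw [hx hxΩ, norm_zero]
  have h2 := eLpNorm_le_eLpNorm_mul_rpow_measure_univ (one_le_two : (1 : ℝ≥0∞) ≤ 2)
    hfr.aestronglyMeasurable
  have h3 := ENNReal.toReal_mono (ENNReal.mul_ne_top hfr.eLpNorm_ne_top
    (ENNReal.rpow_ne_top_of_nonneg (by norm_num) (by simpa using hΩ))) h2
  rw [toReal_eLpNorm hfr.aestronglyMeasurable, lpNorm_one_eq_integral_norm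
    hfr.aestronglyMeasurable, ENNReal.toReal_mul, toReal_eLpNorm hfr.aestronglyMeasurable,
    ← ENNReal.toReal_rpow] at h3
  rw [h1, mul_comm, Real.sqrt_eq_rpow]
  convert! h3 using 3
  · simp [Measure.real]
  · norm_num

theorem lpNorm_two_restrict_le_of_bounded (hΩ : volume Ω ≠ ⊤)
    {u : EuclideanSpace ℝ (Fin n) → ℂ} {B : ℝ} (hB : ∀ x, ‖u x‖ ≤ B)
    (hu : AEStronglyMeasurable u) :
    lpNorm u 2 (volume.restrict Ω) ≤ √(volume.real Ω) * B := by
  have hB0 : 0 ≤ B := (norm_nonneg _).trans (hB 0)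
  have h := eLpNorm_le_of_ae_bound (p := 2) (μ := volume.restrict Ω)
    (Eventually.of_forall fun x => hB x)
  rw [Measure.restrict_apply_univ] at h
  have h' := ENNReal.toReal_mono (ENNReal.mul_ne_top
    (ENNReal.rpow_ne_top_of_nonneg (by norm_num) hΩ) ENNReal.ofReal_ne_top) h
  rw [toReal_eLpNorm hu.restrict, ENNReal.toReal_mul, ← ENNReal.toReal_rpow,
    ENNReal.toReal_ofReal hB0] at h'
  rw [Real.sqrt_eq_rpow]
  convert! h' using 3
  norm_num

end Bounds

end

/-! ### Assembly of the two pieces. -/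

theorem mainTheorem2 {n : ℕ} (j : Fin n)
    (Ω : Set (EuclideanSpace ℝ (Fin n))) (hΩ : IsOpen Ω) (hΩb : Bornology.IsBounded Ω)
    (ρ : ℝ) (hρ : 0 < ρ)
    (φ : EuclideanSpace ℝ (Fin n) → ℂ) (hφ : ContDiff ℝ ∞ φ) (hφc : HasCompactSupport φ)
    (hφρ : tsupport φ ⊆ Metric.ball 0 ρ)
    (f : EuclideanSpace ℝ (Fin n) → ℂ) (hf : MemLp f 2 volume)
    (hfΩ : ∀ᵐ x, x ∉ Ω → f x = 0) :
    ∃ (U : 𝓢'(EuclideanSpace ℝ (Fin n), ℂ)) (u : EuclideanSpace ℝ (Fin n) → ℂ),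
      IsSingularIntegralOf φ j f U ∧ IsGivenBy U u ∧ MemLp u 2 volume ∧
      lpNorm u 2 (volume.restrict Ω) ≤
        ((2 : ℝ) ^ (((n : ℝ) - 1) / 2) *
            (ρ⁻¹ * lpNorm φ 1 volume +
              ρ * lpNorm (partialDeriv j (partialDeriv j φ)) 1 volume) +
          2 ^ n * volume.real Ω * lpNorm (partialDeriv j φ) ∞ volume) *
        lpNorm f 2 (volume.restrict Ω) := by
  have hΩfin : volume Ω ≠ ⊤ := hΩb.measure_lt_top.ne
  have : IsFiniteMeasure (volume.restrict Ω) := ⟨by simpa using hΩfin.lt_top⟩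
  have hf1 : Integrable f := by
    refine IntegrableOn.integrable_of_ae_notMem_eq_zero (s := Ω) ?_ hfΩ
    exact memLp_one_iff_integrable.1 ((hf.restrict Ω).mono_exponent one_le_two)
  -- `φ` and its derivatives as Schwartz functions
  obtain ⟨Φ, hΦ⟩ : ∃ Φ : 𝓢(EuclideanSpace ℝ (Fin n), ℂ), ⇑Φ = φ :=
    ⟨hφc.toSchwartzMap hφ, rfl⟩
  obtain ⟨Ψ, hΨ⟩ : ∃ Ψ : 𝓢(EuclideanSpace ℝ (Fin n), ℂ), ⇑Ψ = partialDeriv j φ :=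
    ⟨_, (partialDeriv_eq_lineDerivOp j Φ fun x => congrFun hΦ x).symm⟩
  obtain ⟨Θ, hΘ⟩ : ∃ Θ : 𝓢(EuclideanSpace ℝ (Fin n), ℂ),
      ⇑Θ = partialDeriv j (partialDeriv j φ) :=
    ⟨_, (partialDeriv_eq_lineDerivOp j Ψ fun x => congrFun hΨ x).symm⟩
  have hψ1 : Integrable (partialDeriv j φ) := hΨ ▸ Ψ.integrable
  have hM := norm_le_lpNorm_top (continuous_partialDeriv hφ j) (hΨ ▸ Ψ.memLp ⊤ volume)
  set a := lpNorm φ 1 volume with ha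
  set b := lpNorm (partialDeriv j (partialDeriv j φ)) 1 volume with hb
  set M := lpNorm (partialDeriv j φ) ⊤ volume with hMdef
  have ha0 : 0 ≤ a := lpNorm_nonneg
  have hb0 : 0 ≤ b := lpNorm_nonneg
  have hM0 : 0 ≤ M := lpNorm_nonneg
  -- the symbols
  set m := 𝓕 (partialDeriv j φ) with hm
  set F := 𝓕 f with hF
  have hmc : Continuous m := by
    rw [hm, ← hΨ, ← SchwartzMap.fourier_coe]
    exact (𝓕 Ψ : 𝓢(EuclideanSpace ℝ (Fin n), ℂ)).continuous
  have hFc : Continuous F := VectorFourier.fourierIntegral_continuous Real.continuous_fourierChar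
    (by exact continuous_inner) hf1
  have h1 : ∀ η, ‖m η‖ ≤ 2 * Real.pi * |η j| * a := by
    intro η
    rw [hm, ← hΦ, norm_fourier_partialDeriv, ha, ← hΦ]
    gcongr
    exact norm_fourier_le_lpNorm_one Φ η
  have h2 : ∀ η, 2 * Real.pi * |η j| * ‖m η‖ ≤ b := by
    intro η
    rw [hm, ← hΨ, ← norm_fourier_partialDeriv, hΨ, hb, ← hΘ]
    exact norm_fourier_le_lpNorm_one Θ η
  set K := ENNReal.ofReal ((2 : ℝ) ^ (((n : ℝ) - 1) / 2) * (ρ⁻¹ * a + ρ * b)) *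
    eLpNorm F 2 volume with hK
  have hH : ∫⁻ ξ, symbolMajorant m F ξ ^ 2 ≤ K ^ 2 :=
    eLpNorm_symbolMajorant_le hmc hFc ha0 hb0 hρ h1 h2
  have hKfin : K ≠ ⊤ := ENNReal.mul_ne_top (by finiteness) (memLp_two_fourier hf1 hf).eLpNorm_ne_top
  have hHfin : ∫⁻ ξ, symbolMajorant m F ξ ^ 2 ≠ ⊤ := ne_top_of_le_ne_top (by finiteness) hH
  have hG : eLpNorm (shellSymbol m F 0 (1 / 2)) 2 volume ≤ K := eLpNorm_shellSymbol_le le_rfl hH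
  have hGm : MemLp (shellSymbol m F 0 (1 / 2)) 2 :=
    ⟨(stronglyMeasurable_shellSymbol hmc hFc _ _).aestronglyMeasurable,
      hG.trans_lt hKfin.lt_top⟩
  obtain ⟨u₁, hu₁, hu₁n, hu₁g⟩ := exists_fourierInv_of_memLp_two hGm
  -- the contribution of `1 / 2 < t ≤ 1`
  set u₂ := shellOp φ j f (1 / 2) 1 with hu₂def
  have hu₂i : Integrable u₂ := integrable_shellOp hφ hψ1 hf1 (by norm_num)
  have hu₂b : ∀ x, ‖u₂ x‖ ≤ 2 ^ n * M * ∫ y, ‖f y‖ := by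
    intro x
    refine (norm_shellOp_le hφ hM hf1 (by norm_num) (by norm_num) x).trans (le_of_eq ?_)
    -- The shell has length `1/2` and the kernel bound is `2^(n+1) M`, whence `2^n M`.
    rw [one_div, inv_pow, inv_inv, pow_succ]
    ring
  have hu₂ : MemLp u₂ 2 := memLp_two_of_integrable_of_bounded hu₂i hu₂b
  obtain ⟨U, hU⟩ := exists_isGivenBy one_le_two (hu₁.add hu₂)
  -- the truncations
  have hT : ∀ ε ∈ Ioo (0 : ℝ) 1, ∃ S : 𝓢'(EuclideanSpace ℝ (Fin n), ℂ),
      IsGivenBy S (truncatedOp φ j ε f) := by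
    intro ε hε
    rw [truncatedOp_eq_shellOp hφ hM hf1 hε.1 hε.2.le]
    exact exists_isGivenBy le_rfl
      (memLp_one_iff_integrable.2 (integrable_shellOp hφ hψ1 hf1 hε.1))
  choose! S hS using hT
  have hgi : ∀ (g : 𝓢(EuclideanSpace ℝ (Fin n), ℂ)) {v : EuclideanSpace ℝ (Fin n) → ℂ},
      MemLp v 2 → Integrable fun x => g x * v x := fun g v hv =>
    (g.memLp 2 volume).integrable_mul hv
  refine ⟨U, u₁ + u₂, ⟨?_, S, hS, ?_⟩, hU, hu₁.add hu₂, ?_⟩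
  · intro ε hε x
    exact integrable_singularIntegrand hφ hM hf1 hε.1 x
  · rw [PointwiseConvergenceCLM.tendsto_iff_forall_tendsto]
    intro g
    have hUg : U g = (∫ ξ, (𝓕⁻ g : 𝓢(EuclideanSpace ℝ (Fin n), ℂ)) ξ *
        shellSymbol m F 0 (1 / 2) ξ) + ∫ x, g x * u₂ x := by
      rw [(hU g).2, ← hu₁g, ← integral_add (hgi g hu₁) (hgi g hu₂)]
      simp only [Pi.add_apply, mul_add]
    rw [hUg]
    -- Only the part `ε < t ≤ 1/2` varies with `ε`; its pairing with `g` is moved to the Fourier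
    -- side.
    refine ((tendsto_integral_mul_shellSymbol hmc hFc hHfin (𝓕⁻ g)).add_const _).congr' ?_
    filter_upwards [Ioc_mem_nhdsGT (by norm_num : (0 : ℝ) < 1 / 2)] with ε hε
    have hε1 : ε < 1 := hε.2.trans_lt (by norm_num)
    have hi : Integrable (shellOp φ j f ε (1 / 2)) := integrable_shellOp hφ hψ1 hf1 hε.1
    have hi2 : MemLp (shellOp φ j f ε (1 / 2)) 2 :=
      memLp_two_of_integrable_of_bounded hi (norm_shellOp_le hφ hM hf1 hε.1 hε.2)
    have hsym : 𝓕 (shellOp φ j f ε (1 / 2)) = shellSymbol m F ε (1 / 2) :=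
      funext fun ξ => fourier_shellOp hφ hψ1 hf1 hε.1 ξ
    rw [(hS ε ⟨hε.1, hε1⟩ g).2, truncatedOp_eq_shellOp hφ hM hf1 hε.1 hε1.le, ← hsym,
      ← integral_mul_eq_integral_fourierInv_mul_fourier hi,
      ← integral_add (hgi g hi2) (hgi g hu₂)]
    refine integral_congr_ae (Eventually.of_forall fun x => ?_)
    simp only
    rw [← shellOp_add_shellOp hφ hM hf1 hε.1 hε.2 (by norm_num : (1 / 2 : ℝ) ≤ 1) x, mul_add]
  · have hfr : eLpNorm f 2 volume = eLpNorm f 2 (volume.restrict Ω) := by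
      rw [← eLpNorm_indicator_eq_eLpNorm_restrict hΩ.measurableSet]
      refine eLpNorm_congr_ae ?_
      filter_upwards [hfΩ] with x hx
      by_cases hxΩ : x ∈ Ω
      · rw [indicator_of_mem hxΩ]
      · rw [indicator_of_notMem hxΩ, hx hxΩ]
    have hb₁ : lpNorm u₁ 2 (volume.restrict Ω) ≤
        (2 : ℝ) ^ (((n : ℝ) - 1) / 2) * (ρ⁻¹ * a + ρ * b) * lpNorm f 2 (volume.restrict Ω) := by
      have h := ENNReal.toReal_mono hKfin (((eLpNorm_restrict_le u₁ 2 volume Ω).trans_eq hu₁n).trans hG)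
      rw [hK, hF, eLpNorm_two_fourier hf1 hf, hfr, ENNReal.toReal_mul,
        ENNReal.toReal_ofReal (by positivity), toReal_eLpNorm hf.aestronglyMeasurable.restrict,
        toReal_eLpNorm hu₁.aestronglyMeasurable.restrict] at h
      exact h
    have hb₂ : lpNorm u₂ 2 (volume.restrict Ω) ≤
        2 ^ n * volume.real Ω * M * lpNorm f 2 (volume.restrict Ω) := by
      calc lpNorm u₂ 2 (volume.restrict Ω)
          ≤ √(volume.real Ω) * (2 ^ n * M * ∫ y, ‖f y‖) :=
            lpNorm_two_restrict_le_of_bounded hΩfin hu₂b hu₂.aestronglyMeasurable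
        _ ≤ √(volume.real Ω) * (2 ^ n * M *
              (√(volume.real Ω) * lpNorm f 2 (volume.restrict Ω))) := by
            gcongr
            exact integral_norm_le_sqrt_mul_lpNorm hΩfin hf hfΩ
        _ = 2 ^ n * (√(volume.real Ω) * √(volume.real Ω)) * M *
              lpNorm f 2 (volume.restrict Ω) := by ring
        _ = _ := by rw [Real.mul_self_sqrt measureReal_nonneg]
    calc lpNorm (u₁ + u₂) 2 (volume.restrict Ω)
        ≤ lpNorm u₁ 2 (volume.restrict Ω) + lpNorm u₂ 2 (volume.restrict Ω) :=
          lpNorm_add_le (hu₁.restrict Ω) one_le_two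
      _ ≤ _ := add_le_add hb₁ hb₂
      _ = _ := by ring
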